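/- Let $\mathbb{F}_q$ be a finite field, $\mathbb{F}_{q^m}$ its extension of degree $m$, $\theta(x)=x^q$ the $q$-Frobenius automorphism, $\mathrm{Tr}=\mathrm{Tr}_{\mathbb{F}_{q^m}/\mathbb{F}_q}$, $s$ an integer coprime to $m$, and $\sigma:=\theta^s$. Fix $\gamma\in\mathbb{F}_{q^m}$ with $\mathrm{Tr}(\gamma)\neq 0$. For $v=(v_1,\dots,v_\ell)\in\mathbb{F}_{q^m}^\ell$ put $\mathrm{supp}_q(v)=\langle v_1,\dots,v_\ell\rangle_{\mathbb{F}_q}$ and $\mathrm{rk}_q(v)=\dim_{\mathbb{F}_q}\mathrm{supp}_q(v)$. For an $\mathbb{F}_q$-subspace $S\subseteq \mathbb{F}_{q^m}$ let $S^{\times}=\{b\in\mathbb{F}_{q^m} : \mathrm{Tr}(ab)=0 \text{ for all } a\in S\}$. The $k\times \ell$ $s$-Moore matrix is $M_{k,s}(v)=\bigl(\theta^{(i-1)s}(v_j)\bigr)_{1\le i\le k,\,1\le j\le \ell}$. Define $$\pi_s(a)=\frac{-1}{\mathrm{Tr}(\gamma)}\sum_{i=0}^{m-2}\Bigl(\sigma^{i+1}(\gamma)\sum_{j=0}^{i}\sigma^j(a)\Bigr),\qquad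 a\in\mathbb{F}_{q^m}.$$ A $t\times r$ matrix $R$ over $\mathbb{F}_{q^m}$ is called a *$(q,s)$-Cauchy matrix* if there are $\alpha\in\mathbb{F}_{q^m}^t$, $\beta\in\mathbb{F}_{q^m}^r$ and $B\in\mathbb{F}_q^{t\times r}$ with $\mathrm{rk}_q(\alpha)=t$, $\mathrm{rk}_q(\beta)=r$, $\mathrm{supp}_q(\beta)\subseteq\mathrm{supp}_q(\alpha)^{\times}$ and $R=\bigl(\pi_s(\alpha_i\beta_j)\bigr)_{i,j}+B$. 1. Let $0<k<n\le m$ and let $g\in\mathbb{F}_{q^m}^n$ satisfy $\mathrm{rk}_q(g)=n$. Then $M_{k,s}(g_1,\dots,g_k)$ is invertible and $$M_{k,s}(g_1,\dots,g_k)^{-1}M_{k,s}(g_{k+1},\dots,g_n)$$ is a $(q,s)$-Cauchy matrix in $\mathbb{F}_{q^m}^{k\times(n-k)}$. 2. Conversely, if $R\in\mathbb{F}_{q^m}^{t\times r}$ is a $(q,s)$-Cauchy matrix, then there exists $g=(g_1,\dots,g_{t+r})\in\mathbb{F}_{q^m}^{t+r}$ with $\mathrm{rk}_q(g)=t+r$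 such that $M_{t,s}(g_1,\dots,g_t)$ is invertible and $$R=M_{t,s}(g_1,\dots,g_t)^{-1}M_{t,s}(g_{t+1},\dots,g_{t+r}).$$ -/

import Mathlib

/-! Throughout, `F` is the finite field `𝔽_q` with `q = Fintype.card F`, and `K` is the extension
field `𝔽_{q^m}` with `m = Module.finrank F K`. -/

noncomputable section

namespace QCauchy

variable (F : Type*) {K : Type*} [Field F] [Field K] [Algebra F K]

/-- The support `supp_q(g) = ⟨g_1, …, g_n⟩` over `𝔽_q` of a vector `g`. -/
def supp {ι : Type*} (g : ι → K) : Submodule F K :=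
  Submodule.span F (Set.range g)

/-- The `q`-rank `rk_q(g) = dim_{𝔽_q} supp_q(g)`. -/
def qRank {ι : Type*} (g : ι → K) : ℕ :=
  Module.finrank F (supp F g)

/-- The trace-orthogonal space `S^× = {b | Tr(a b) = 0 for all a ∈ S}`. -/
def traceOrthogonal (S : Submodule F K) : Submodule F K :=
  (Algebra.traceForm F K).orthogonal S

section Frobenius

variable [Fintype F] [FiniteDimensional F K]

variable (K) in
/-- The automorphism `σ = θ^s` of `K` over `F`, where `θ : x ↦ x ^ q`. -/
def sigma (s : ℤ) : K ≃ₐ[F] K :=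
  FiniteField.frobeniusAlgEquivOfAlgebraic F K ^ s

/-- The `k × n` `s`-Moore matrix `M_{k,s}(v)`; the row with index `i` (counted from `0`) is
`θ^{is}(v_1), …, θ^{is}(v_n)`. -/
def moore {n : ℕ} (k : ℕ) (s : ℤ) (v : Fin n → K) : Matrix (Fin k) (Fin n) K :=
  Matrix.of fun i j => sigma F K ((i : ℤ) * s) (v j)

/-- The map `π_s` (built with a fixed `γ` of nonzero trace):
`π_s(a) = -1 / Tr(γ) * ∑_{i=0}^{m-2} σ^{i+1}(γ) * ∑_{j=0}^{i} σ^j(a)`, where `σ = θ^s`. -/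
def piMap (γ : K) (s : ℤ) (a : K) : K :=
  -1 / algebraMap F K (Algebra.trace F K γ) *
    ∑ i ∈ Finset.range (Module.finrank F K - 1),
      (sigma F K s ^ (i + 1)) γ * ∑ j ∈ Finset.range (i + 1), (sigma F K s ^ j) a

/-- The matrix `(π_s(α_i β_j))_{i,j} + B`. -/
def cauchyMatrix (γ : K) (s : ℤ) {t r : ℕ} (α : Fin t → K) (β : Fin r → K)
    (B : Matrix (Fin t) (Fin r) F) : Matrix (Fin t) (Fin r) K :=
  Matrix.of (fun i j => piMap F γ s (α i * β j)) + B.map (algebraMap F K)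

/-- `R` is a `t × r` `(q,s)`-Cauchy matrix. -/
def IsCauchy (γ : K) (s : ℤ) {t r : ℕ} (R : Matrix (Fin t) (Fin r) K) : Prop :=
  IsCoprime s (Module.finrank F K : ℤ) ∧
  ∃ (α : Fin t → K) (β : Fin r → K) (B : Matrix (Fin t) (Fin r) F),
    qRank F α = t ∧ qRank F β = r ∧ supp F β ≤ traceOrthogonal F (supp F α) ∧
      R = cauchyMatrix F γ s α β B

end Frobenius

end QCauchy

end

namespace QCauchy

open scoped Matrix

/-! ### Moore systems for an automorphism `σ` with fixed field `F` -/

section Generator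

variable {F K : Type*} [Field F] [Field K] [Algebra F K] {σ : K ≃ₐ[F] K}

/-! With `σ` a generator of the Galois group, `R` is Cauchy iff `σ(R) - R = α βᵀ` with `α` and `β`
each `F`-independent: `π_s` inverts `σ - 1` on trace-zero elements (additive Hilbert 90,
`sigma_piMap_sub`), and `B` absorbs the kernel `F`. On the other side, `R = M(g)⁻¹ M(h)` says `∑ i,
σ^l(g_i) R_ij = σ^l(h_j)` for `l < k`. Applying `σ` to row `l` and subtracting row `l + 1` puts the
columns of `σ(R) - R` in the kernel of the `(k-1) × k` Moore matrix of `σ(g)`. That kernel is a line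
spanned by a vector with independent entries (`linearIndependent_of_moore_mulVec_eq_zero`), which is
`α`. The converse recovers `g` from `α` by the same duality for `σ⁻¹`. -/

theorem map_sigma_pow_succ (σ : K ≃ₐ[F] K) (l : ℕ) (x : K) :
    (σ ^ (l + 1)) x = σ ((σ ^ l) x) := by
  rw [pow_succ', AlgEquiv.mul_apply]

theorem map_sigma_pow_succ' (σ : K ≃ₐ[F] K) (l : ℕ) (x : K) :
    (σ ^ (l + 1)) x = (σ ^ l) (σ x) := by
  rw [pow_succ, AlgEquiv.mul_apply]

theorem linearIndependent_map {ι : Type*} {g : ι → K} (hg : LinearIndependent F g)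
    (σ : K ≃ₐ[F] K) : LinearIndependent F fun i => σ (g i) :=
  hg.map' σ.toLinearMap (LinearMap.ker_eq_bot.2 σ.injective)

/-- If the fixed field of `σ` is `F`, the columns of the square Moore matrix of an
`F`-independent family are linearly independent over `K`. -/
theorem eq_zero_of_moore_mulVec_eq_zero
    (hfix : ∀ x, σ x = x → ∃ c, algebraMap F K c = x) {n : ℕ} {g : Fin n → K}
    (hg : LinearIndependent F g) {x : Fin n → K}
    (hx : ∀ l < n, ∑ i, x i * (σ ^ l) (g i) = 0) : x = 0 := by
  induction n with
  | zero => exact Subsingleton.elim _ _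
  | succ n ih =>
    by_contra hne
    obtain ⟨p, hp⟩ := Function.ne_iff.1 hne
    simp only [Pi.zero_apply] at hp
    -- Normalising one entry to 1 makes `σ(y) - y` vanish there, so a shorter relation for `σ(g)`
    -- remains, as in Artin's lemma.
    set y : Fin (n + 1) → K := fun i => (x p)⁻¹ * x i with hy
    have hyp : y p = 1 := inv_mul_cancel₀ hp
    have hy0 : ∀ l < n + 1, ∑ i, y i * (σ ^ l) (g i) = 0 := fun l hl => by
      simp only [hy, mul_assoc, ← Finset.mul_sum, hx l hl, mul_zero]
    have hdiff : ∀ l < n, ∑ i, (σ (y i) - y i) * (σ ^ l) (σ (g i)) = 0 := fun l hl => by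
      have h1 := congrArg σ (hy0 l (by omega))
      have h2 := hy0 (l + 1) (by omega)
      simp only [map_sum, map_mul, map_zero, ← map_sigma_pow_succ] at h1
      simp only [← map_sigma_pow_succ', sub_mul, Finset.sum_sub_distrib, h1, h2, sub_zero]
    have hdiffp : ∀ l < n, ∑ i, (σ (y (p.succAbove i)) - y (p.succAbove i)) *
        (σ ^ l) (σ (g (p.succAbove i))) = 0 := fun l hl => by
      have := hdiff l hl
      rwa [Fin.sum_univ_succAbove _ p, hyp, map_one, sub_self, zero_mul, zero_add] at this
    have hz := ih ((linearIndependent_map hg σ).comp _ (Fin.succAbove_right_injective (p := p)))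
      (x := fun i => σ (y (p.succAbove i)) - y (p.succAbove i)) hdiffp
    have hyfix : ∀ i, σ (y i) = y i := fun i => by
      rcases Fin.eq_self_or_eq_succAbove p i with rfl | ⟨j, rfl⟩
      · rw [hyp, map_one]
      · exact sub_eq_zero.1 (congrFun hz j)
    choose c hc using fun i => hfix _ (hyfix i)
    have h0 := hy0 0 (by omega)
    simp only [pow_zero, AlgEquiv.one_apply, ← hc, ← Algebra.smul_def] at h0
    have hcp := Fintype.linearIndependent_iff.1 hg c h0 p
    rw [← hc p, hcp, map_zero] at hyp
    exact zero_ne_one hyp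

/-- A nonzero vector in the kernel of the `n × (n + 1)` Moore matrix of an `F`-independent family
has `F`-independent entries. -/
theorem linearIndependent_of_moore_mulVec_eq_zero
    (hfix : ∀ x, σ x = x → ∃ c, algebraMap F K c = x) {n : ℕ} {g : Fin (n + 1) → K}
    (hg : LinearIndependent F g) {x : Fin (n + 1) → K}
    (hx : ∀ l < n, ∑ i, x i * (σ ^ l) (g i) = 0) (hne : x ≠ 0) : LinearIndependent F x := by
  rw [Fintype.linearIndependent_iff]
  intro c hc
  by_contra! hcp
  obtain ⟨p, hp⟩ := hcp
  set d : Fin (n + 1) → F := fun i => (c p)⁻¹ * c i with hd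
  have hdx : x p = -∑ i, d (p.succAbove i) • x (p.succAbove i) := by
    rw [eq_neg_iff_add_eq_zero]
    have : ∑ i, d i • x i = 0 := by simp only [hd, mul_smul, ← Finset.smul_sum, hc, smul_zero]
    rwa [Fin.sum_univ_succAbove _ p, show d p = 1 from inv_mul_cancel₀ hp, one_smul] at this
  -- Eliminating `x p` leaves a square Moore system in the elements `g_i - d_i g_p`.
  have hli : LinearIndependent F fun i => g (p.succAbove i) - d (p.succAbove i) • g p := by
    rw [Fintype.linearIndependent_iff]
    intro e he
    have hsum : ∑ i, (p.insertNth (-∑ i, e i * d (p.succAbove i)) e : Fin (n + 1) → F) i • g i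
        = 0 := by
      rw [Fin.sum_univ_succAbove _ p]
      simp only [Fin.insertNth_apply_same, Fin.insertNth_apply_succAbove]
      rw [← he]
      simp only [smul_sub, Finset.sum_sub_distrib, smul_smul, ← Finset.sum_smul, neg_smul]
      abel
    intro i
    simpa using Fintype.linearIndependent_iff.1 hg _ hsum (p.succAbove i)
  have hz := eq_zero_of_moore_mulVec_eq_zero hfix hli (x := fun i => x (p.succAbove i))
    fun l hl => by
      rw [← hx l hl, Fin.sum_univ_succAbove _ p, hdx]
      simp only [map_sub, map_smul, mul_sub, Finset.sum_sub_distrib, neg_mul, Finset.sum_mul,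
        smul_mul_assoc, mul_smul_comm]
      abel
  refine hne (funext fun i => ?_)
  have hz' : ∀ j, x (p.succAbove j) = 0 := congrFun hz
  rcases Fin.eq_self_or_eq_succAbove p i with rfl | ⟨j, rfl⟩
  · simp [hdx, hz']
  · exact hz' j

theorem exists_moore_mulVec_eq_zero (σ : K ≃ₐ[F] K) {n : ℕ} (g : Fin (n + 1) → K) :
    ∃ x : Fin (n + 1) → K, x ≠ 0 ∧ ∀ l < n, ∑ i, x i * (σ ^ l) (g i) = 0 := by
  let M : Matrix (Fin n) (Fin (n + 1)) K := Matrix.of fun l i => (σ ^ (l : ℕ)) (g i)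
  have h : LinearMap.ker M.mulVecLin ≠ ⊥ := LinearMap.ker_ne_bot_of_finrank_lt (by simp)
  obtain ⟨x, hx, hne⟩ := Submodule.exists_mem_ne_zero_of_ne_bot h
  refine ⟨x, hne, fun l hl => ?_⟩
  have := congrFun (LinearMap.mem_ker.1 hx) ⟨l, hl⟩
  simpa [M, Matrix.mulVec, dotProduct, mul_comm] using this

variable [FiniteDimensional F K]

theorem exists_algebraMap_eq_of_map_eq [IsGalois F K]
    (hσ : ∀ τ : K ≃ₐ[F] K, τ ∈ Subgroup.zpowers σ) {x : K} (hx : σ x = x) :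
    ∃ c, algebraMap F K c = x := by
  refine (IsGalois.mem_range_algebraMap_iff_fixed x).2 fun τ => ?_
  have hle : Subgroup.zpowers σ ≤ MulAction.stabilizer (K ≃ₐ[F] K) x := by
    rw [Subgroup.zpowers_le]; exact hx
  exact hle (hσ τ)

theorem algebraMap_trace_eq_sum_pow [IsGalois F K]
    (hσ : ∀ τ : K ≃ₐ[F] K, τ ∈ Subgroup.zpowers σ) (x : K) :
    algebraMap F K (Algebra.trace F K x) =
      ∑ i ∈ Finset.range (Module.finrank F K), (σ ^ i) x := by
  classical
  have hcard : orderOf σ = Module.finrank F K := by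
    rw [orderOf_eq_card_of_forall_mem_zpowers hσ, IsGalois.card_aut_eq_finrank]
  rw [trace_eq_sum_automorphisms, ← IsCyclic.image_range_orderOf hσ, hcard, Finset.sum_image]
  intro i hi j hj hij
  rw [← hcard] at hi hj
  exact pow_injOn_Iio_orderOf (by simpa using hi) (by simpa using hj) hij

end Generator

section Qrank

variable {F K : Type*} [Field F] [Field K] [Algebra F K]

theorem qRank_eq_iff {n : ℕ} {g : Fin n → K} : qRank F g = n ↔ LinearIndependent F g := by
  rw [linearIndependent_iff_card_eq_finrank_span, Fintype.card_fin, eq_comm]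
  rfl

theorem supp_le_traceOrthogonal_iff {t r : ℕ} {α : Fin t → K} {β : Fin r → K} :
    supp F β ≤ traceOrthogonal F (supp F α) ↔
      ∀ i j, Algebra.trace F K (α i * β j) = 0 := by
  constructor
  · intro h i j
    exact h (Submodule.subset_span ⟨j, rfl⟩) (α i) (Submodule.subset_span ⟨i, rfl⟩)
  · intro h
    rw [supp, Submodule.span_le]
    rintro _ ⟨j, rfl⟩ a ha
    induction ha using Submodule.span_induction with
    | mem x hx => obtain ⟨i, rfl⟩ := hx; exact h i j
    | zero => simp
    | add x y _ _ hx hy => simp_all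
    | smul c x _ hx => simp_all

end Qrank

/-! ### The case `σ = θ^s`: the map `π_s` and Cauchy matrices -/

section Frobenius

variable {F K : Type*} [Field F] [Fintype F] [Field K] [Algebra F K] [FiniteDimensional F K]
  {s : ℤ}

theorem mem_zpowers_sigma (hs : IsCoprime s (Module.finrank F K : ℤ)) (τ : K ≃ₐ[F] K) :
    τ ∈ Subgroup.zpowers (sigma F K s) := by
  have : Finite K := Module.finite_of_finite F
  obtain ⟨a, b, hab⟩ := hs
  have hθ : FiniteField.frobeniusAlgEquivOfAlgebraic F K ∈ Subgroup.zpowers (sigma F K s) := by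
    refine ⟨a, ?_⟩
    have hone : FiniteField.frobeniusAlgEquivOfAlgebraic F K ^ (Module.finrank F K : ℤ) = 1 := by
      rw [zpow_natCast, ← FiniteField.orderOf_frobeniusAlgEquivOfAlgebraic, pow_orderOf_eq_one]
    have h := congrArg (FiniteField.frobeniusAlgEquivOfAlgebraic F K ^ ·) hab
    simp only [zpow_add, zpow_one, mul_comm b, zpow_mul _ (Module.finrank F K : ℤ), hone,
      one_zpow, mul_one] at h
    rwa [mul_comm a, zpow_mul] at h
  obtain ⟨n, rfl⟩ := (FiniteField.bijective_frobeniusAlgEquivOfAlgebraic_pow F K).2 τ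
  exact pow_mem hθ _

theorem exists_algebraMap_eq_of_sigma_eq (hs : IsCoprime s (Module.finrank F K : ℤ)) {x : K}
    (hx : sigma F K s x = x) : ∃ c, algebraMap F K c = x :=
  have : Finite K := Module.finite_of_finite F
  exists_algebraMap_eq_of_map_eq (mem_zpowers_sigma hs) hx

theorem moore_apply {n k : ℕ} (v : Fin n → K) (i : Fin k) (j : Fin n) :
    moore F k s v i j = (sigma F K s ^ (i : ℕ)) (v j) := by
  rw [moore, Matrix.of_apply, sigma, sigma, mul_comm, zpow_mul, zpow_natCast]

theorem isUnit_moore (hs : IsCoprime s (Module.finrank F K : ℤ)) {k : ℕ} {g : Fin k → K}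
    (hg : LinearIndependent F g) : IsUnit (moore F k s g) := by
  rw [Matrix.isUnit_iff_isUnit_det, isUnit_iff_ne_zero]
  intro h
  obtain ⟨v, hv, hv0⟩ := Matrix.exists_mulVec_eq_zero_iff.2 h
  refine hv (eq_zero_of_moore_mulVec_eq_zero
    (fun x => exists_algebraMap_eq_of_sigma_eq (s := s) hs) hg fun l hl => ?_)
  have := congrFun hv0 ⟨l, hl⟩
  simpa [Matrix.mulVec, dotProduct, moore_apply, mul_comm] using this

theorem eq_inv_moore_mul_iff (hs : IsCoprime s (Module.finrank F K : ℤ)) {k n : ℕ}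
    {g : Fin k → K} (hg : LinearIndependent F g) {h : Fin n → K} {R : Matrix (Fin k) (Fin n) K} :
    R = (moore F k s g)⁻¹ * moore F k s h ↔
      ∀ l < k, ∀ j, ∑ i, (sigma F K s ^ l) (g i) * R i j = (sigma F K s ^ l) (h j) := by
  have hdet := (Matrix.isUnit_iff_isUnit_det _).1 (isUnit_moore hs hg)
  have : R = (moore F k s g)⁻¹ * moore F k s h ↔ moore F k s g * R = moore F k s h := by
    constructor
    · rintro rfl; exact Matrix.mul_nonsing_inv_cancel_left _ _ hdet
    · intro h; rw [← h, Matrix.nonsing_inv_mul_cancel_left _ _ hdet]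
  rw [this, ← Matrix.ext_iff, Fin.forall_iff]
  simp only [Matrix.mul_apply, moore_apply]

/-- With `T i` the partial sums of the `σ^j(a)`, `σ(T i) = T (i + 1) - a`. Hence `σ` shifts the sum
`∑ σ^i(γ) T i` up to the error `Tr(γ) a`; no boundary terms survive, since `T 0 = 0` and `T (m + 1)
= Tr(a) = 0`. -/
theorem sigma_piMap_sub (hs : IsCoprime s (Module.finrank F K : ℤ)) {γ : K}
    (hγ : Algebra.trace F K γ ≠ 0) {a : K} (ha : Algebra.trace F K a = 0) :
    sigma F K s (piMap F γ s a) - piMap F γ s a = a := by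
  have : Finite K := Module.finite_of_finite F
  have hsum := algebraMap_trace_eq_sum_pow (mem_zpowers_sigma (F := F) (K := K) hs)
  obtain ⟨m, hm⟩ : ∃ m, Module.finrank F K = m + 1 :=
    Nat.exists_eq_succ_of_ne_zero Module.finrank_pos.ne'
  set σ := sigma F K s
  let T : ℕ → K := fun i => ∑ j ∈ Finset.range i, (σ ^ j) a
  have hT : ∀ i, σ (T i) = T (i + 1) - a := fun i => by
    simp only [T, map_sum, ← map_sigma_pow_succ]
    rw [Finset.sum_range_succ' _ i, pow_zero, AlgEquiv.one_apply, add_sub_cancel_right]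
  have hTm : T (m + 1) = 0 := by
    simp only [T]; rw [← hm, ← hsum, ha, map_zero]
  have hpi : piMap F γ s a = -1 / algebraMap F K (Algebra.trace F K γ) *
      ∑ i ∈ Finset.range m, (σ ^ (i + 1)) γ * T (i + 1) := by
    rw [piMap, hm]; rfl
  have hS : σ (∑ i ∈ Finset.range m, (σ ^ (i + 1)) γ * T (i + 1)) =
      ∑ i ∈ Finset.range m, (σ ^ (i + 1)) γ * T (i + 1)
        - algebraMap F K (Algebra.trace F K γ) * a := by
    have h1 : ∑ i ∈ Finset.range m, (σ ^ (i + 1)) γ * T (i + 1) =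
        ∑ i ∈ Finset.range (m + 1), (σ ^ i) γ * T i := by
      rw [Finset.sum_range_succ' _ m]; simp [T]
    have h2 : ∑ i ∈ Finset.range (m + 1), (σ ^ (i + 1)) γ * T (i + 1) =
        ∑ i ∈ Finset.range m, (σ ^ (i + 1)) γ * T (i + 1) := by
      rw [Finset.sum_range_succ, hTm, mul_zero, add_zero]
    have h3 : ∑ i ∈ Finset.range (m + 1), (σ ^ (i + 1)) γ =
        algebraMap F K (Algebra.trace F K γ) := by
      rw [← AlgEquiv.commutes σ, hsum, hm, map_sum]
      simp only [map_sigma_pow_succ]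
    rw [h1]
    simp only [map_sum, map_mul, hT, ← map_sigma_pow_succ, mul_sub, Finset.sum_sub_distrib,
      ← Finset.sum_mul]
    rw [h2, h3, h1]
  have hne : algebraMap F K (Algebra.trace F K γ) ≠ 0 := by simpa using hγ
  rw [hpi, map_mul, hS, map_div₀, map_neg, map_one, AlgEquiv.commutes]
  field_simp
  ring

theorem isCauchy_of_sigma_sub (hs : IsCoprime s (Module.finrank F K : ℤ)) {γ : K}
    (hγ : Algebra.trace F K γ ≠ 0) {t r : ℕ} {R : Matrix (Fin t) (Fin r) K}
    {α : Fin t → K} {β : Fin r → K} (hα : LinearIndependent F α) (hβ : LinearIndependent F β)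
    (hR : ∀ i j, sigma F K s (R i j) - R i j = α i * β j) : IsCauchy F γ s R := by
  have htr : ∀ i j, Algebra.trace F K (α i * β j) = 0 := fun i j => by
    rw [← hR, map_sub, Algebra.trace_eq_of_algEquiv, sub_self]
  have hfix : ∀ i j, ∃ c, algebraMap F K c = R i j - piMap F γ s (α i * β j) := fun i j => by
    refine exists_algebraMap_eq_of_sigma_eq hs ?_
    rw [map_sub]
    linear_combination hR i j - sigma_piMap_sub hs hγ (htr i j)
  choose B hB using hfix
  refine ⟨hs, α, β, Matrix.of B, qRank_eq_iff.2 hα, qRank_eq_iff.2 hβ,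
    supp_le_traceOrthogonal_iff.2 htr, ?_⟩
  ext i j
  simp [cauchyMatrix, hB]

theorem IsCauchy.exists_sigma_sub {γ : K} (hγ : Algebra.trace F K γ ≠ 0) {t r : ℕ}
    {R : Matrix (Fin t) (Fin r) K} (h : IsCauchy F γ s R) :
    ∃ (α : Fin t → K) (β : Fin r → K), LinearIndependent F α ∧ LinearIndependent F β ∧
      ∀ i j, sigma F K s (R i j) - R i j = α i * β j := by
  obtain ⟨hs, α, β, B, hα, hβ, hαβ, rfl⟩ := h
  refine ⟨α, β, qRank_eq_iff.1 hα, qRank_eq_iff.1 hβ, fun i j => ?_⟩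
  have := sigma_piMap_sub hs hγ (supp_le_traceOrthogonal_iff.1 hαβ i j)
  simp only [cauchyMatrix, Matrix.add_apply, Matrix.of_apply, Matrix.map_apply, map_add,
    AlgEquiv.commutes]
  linear_combination this

theorem isCauchy_inv_moore_mul (hs : IsCoprime s (Module.finrank F K : ℤ)) {γ : K}
    (hγ : Algebra.trace F K γ ≠ 0) {k r : ℕ} (hk : 0 < k) {g : Fin k → K} {h : Fin r → K}
    (hgh : LinearIndependent F (Sum.elim g h)) :
    IsCauchy F γ s ((moore F k s g)⁻¹ * moore F k s h) := by
  obtain ⟨k, rfl⟩ := Nat.exists_eq_succ_of_ne_zero hk.ne'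
  have hfix := fun x => exists_algebraMap_eq_of_sigma_eq (F := F) (K := K) (x := x) hs
  have hg : LinearIndependent F g := hgh.comp Sum.inl Sum.inl_injective
  set R := (moore F (k + 1) s g)⁻¹ * moore F (k + 1) s h with hRdef
  have hR := (eq_inv_moore_mul_iff hs hg).1 hRdef
  set σ := sigma F K s
  have hσg := linearIndependent_map hg σ
  obtain ⟨α, hα0, hα⟩ := exists_moore_mulVec_eq_zero σ fun i => σ (g i)
  have hαli := linearIndependent_of_moore_mulVec_eq_zero hfix hσg hα hα0
  have hker : ∀ j, ∀ l < k, ∑ i, (σ (R i j) - R i j) * (σ ^ l) (σ (g i)) = 0 := fun j l hl => by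
    have h1 := congrArg σ (hR l (by omega) j)
    have h2 := hR (l + 1) (by omega) j
    simp only [map_sum, map_mul, ← map_sigma_pow_succ] at h1
    simp only [← map_sigma_pow_succ', sub_mul, Finset.sum_sub_distrib]
    simp only [mul_comm _ ((σ ^ (l + 1)) _), h1, h2, sub_self]
  -- Row 0 determines the factor of each column; `α 0 ≠ 0` by independence.
  set β : Fin r → K := fun j => (σ (R 0 j) - R 0 j) / α 0
  have hαβ : ∀ i j, σ (R i j) - R i j = α i * β j := by
    intro i j
    by_contra hne
    have hne' : (fun i => σ (R i j) - R i j - α i * β j) ≠ 0 := fun h0 =>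
      hne (sub_eq_zero.1 (congrFun h0 i))
    have hli := linearIndependent_of_moore_mulVec_eq_zero hfix hσg (fun l hl => by
      have hsub : ∑ i, (σ (R i j) - R i j - α i * β j) * (σ ^ l) (σ (g i)) =
          ∑ i, (σ (R i j) - R i j) * (σ ^ l) (σ (g i)) -
            β j * ∑ i, α i * (σ ^ l) (σ (g i)) := by
        rw [Finset.mul_sum, ← Finset.sum_sub_distrib]
        exact Finset.sum_congr rfl fun _ _ => by ring
      rw [hsub, hker j l hl, hα l hl, mul_zero, sub_zero]) hne'
    -- A nonzero kernel vector has independent entries, yet this one vanishes at index 0.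
    refine hli.ne_zero 0 ?_
    simp only [β, mul_div_cancel₀ _ (hαli.ne_zero 0), sub_self]
  refine isCauchy_of_sigma_sub hs hγ hαli ?_ hαβ
  rw [Fintype.linearIndependent_iff]
  intro c hc
  -- A relation among the `β j` makes the same combination of columns of `R` fixed by `σ`, hence
  -- `F`-valued; `h = g R` turns it into a relation among `g` and `h`.
  have hu : ∀ i, ∃ u, algebraMap F K u = ∑ j, c j • R i j := fun i => by
    refine hfix _ (sub_eq_zero.1 ?_)
    rw [map_sum, ← Finset.sum_sub_distrib]
    simp only [map_smul, ← smul_sub, hαβ, ← mul_smul_comm, ← Finset.mul_sum, hc, mul_zero]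
  choose u hu using hu
  have hrel : ∑ x, (Sum.elim (fun i => -u i) c : _ → F) x • Sum.elim g h x = 0 := by
    have h0 : ∀ j, h j = ∑ i, g i * R i j := fun j => by simpa using (hR 0 (by omega) j).symm
    rw [Fintype.sum_sum_type]
    simp only [Sum.elim_inl, Sum.elim_inr, neg_smul, Finset.sum_neg_distrib]
    rw [neg_add_eq_zero]
    simp only [Algebra.smul_def, hu, h0, Finset.sum_mul, Finset.mul_sum]
    rw [Finset.sum_comm]
    exact Finset.sum_congr rfl fun _ _ => Finset.sum_congr rfl fun _ _ => by ring
  exact fun j => Fintype.linearIndependent_iff.1 hgh _ hrel (Sum.inr j)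

theorem IsCauchy.exists_eq_inv_moore_mul {γ : K} (hγ : Algebra.trace F K γ ≠ 0) {t r : ℕ}
    {R : Matrix (Fin t) (Fin r) K} (hR : IsCauchy F γ s R) :
    ∃ (g : Fin t → K) (h : Fin r → K), LinearIndependent F (Sum.elim g h) ∧
      R = (moore F t s g)⁻¹ * moore F t s h := by
  have hs := hR.1
  have hfix := fun x => exists_algebraMap_eq_of_sigma_eq (F := F) (K := K) (x := x) hs
  obtain ⟨α, β, hα, hβ, hαβ⟩ := hR.exists_sigma_sub hγ
  obtain _ | t := t
  -- For `t = 0` there is no row to use, but `g` is empty and `h = β` serves.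
  · refine ⟨α, β, ?_, Subsingleton.elim _ _⟩
    exact (linearIndependent_equiv' (Equiv.emptySum (Fin 0) (Fin r)).symm rfl).1 hβ
  set σ := sigma F K s
  have hfix' : ∀ x, σ⁻¹ x = x → ∃ c, algebraMap F K c = x := fun x hx =>
    hfix x (by conv_lhs => rw [← hx, ← AlgEquiv.mul_apply, mul_inv_cancel, AlgEquiv.one_apply])
  have hσα := linearIndependent_map hα σ⁻¹
  -- The wanted equations `∑ i, σ^(l+1)(g_i) α_i = 0`, pulled back by `σ^(l+1)`, form a Moore system
  -- for `σ⁻¹` with unknown `g`.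
  obtain ⟨g, hg0, hg⟩ := exists_moore_mulVec_eq_zero σ⁻¹ fun i => σ⁻¹ (α i)
  have hgli := linearIndependent_of_moore_mulVec_eq_zero hfix' hσα hg hg0
  have hgα : ∀ l < t, ∑ i, (σ ^ (l + 1)) (g i) * α i = 0 := fun l hl => by
    have := congrArg (σ ^ (l + 1)) (hg l hl)
    have hcancel : ∀ i, (σ ^ (l + 1)) ((σ⁻¹ ^ l) (σ⁻¹ (α i))) = α i := fun i => by
      rw [← map_sigma_pow_succ' σ⁻¹, inv_pow, ← AlgEquiv.mul_apply, mul_inv_cancel,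
        AlgEquiv.one_apply]
    simpa only [map_sum, map_mul, map_zero, hcancel] using this
  -- Row `l = 0` forces this choice; the other rows follow because `σ^(l+1)(g)` is orthogonal to
  -- `α`.
  let h : Fin r → K := fun j => ∑ i, g i * R i j
  have hgR : ∀ l < t + 1, ∀ j, ∑ i, (σ ^ l) (g i) * R i j = (σ ^ l) (h j) := by
    intro l
    induction l with
    | zero => intro _ j; simp [h]
    | succ l ih =>
      intro hl j
      have hσR : ∀ i, σ (R i j) = R i j + α i * β j := fun i => by rw [← hαβ]; ring
      rw [map_sigma_pow_succ σ l (h j), ← ih (by omega) j]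
      simp only [map_sum, map_mul, ← map_sigma_pow_succ, hσR, mul_add, Finset.sum_add_distrib,
        ← mul_assoc, ← Finset.sum_mul, hgα l (by omega), zero_mul, add_zero]
  refine ⟨g, h, ?_, (eq_inv_moore_mul_iff hs hgli).2 hgR⟩
  rw [Fintype.linearIndependent_iff]
  intro c hc
  simp only [Fintype.sum_sum_type, Sum.elim_inl, Sum.elim_inr] at hc
  have hu := eq_zero_of_moore_mulVec_eq_zero hfix hgli
    (x := fun i => algebraMap F K (c (Sum.inl i)) + ∑ j, c (Sum.inr j) • R i j) fun l hl => by
      have h1 := congrArg (σ ^ l) hc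
      simp only [map_add, map_sum, map_smul, map_zero, ← hgR l hl, Finset.smul_sum] at h1
      rw [Finset.sum_comm, ← Finset.sum_add_distrib] at h1
      rw [← h1]
      refine Finset.sum_congr rfl fun i _ => ?_
      simp only [add_mul, Algebra.smul_def, Finset.sum_mul]
      congr 1
      exact Finset.sum_congr rfl fun _ _ => by ring
  have hu' : ∀ i, algebraMap F K (c (Sum.inl i)) + ∑ j, c (Sum.inr j) • R i j = 0 := congrFun hu
  -- Applying `σ - 1` removes the constant in `F` and leaves `α 0 * ∑ c_j β_j = 0`.
  have hcβ : ∑ j, c (Sum.inr j) • β j = 0 := by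
    have h1 := congrArg σ (hu' 0)
    simp only [map_add, map_sum, map_smul, map_zero, AlgEquiv.commutes] at h1
    have h2 : ∑ j, c (Sum.inr j) • (σ (R 0 j) - R 0 j) = 0 := by
      simp only [smul_sub, Finset.sum_sub_distrib]
      linear_combination h1 - hu' 0
    simp only [hαβ, ← mul_smul_comm, ← Finset.mul_sum] at h2
    exact (mul_eq_zero.1 h2).resolve_left (hα.ne_zero 0)
  have hr := Fintype.linearIndependent_iff.1 hβ _ hcβ
  rintro (i | j)
  · simpa [hr] using hu' i
  · exact hr j

end Frobenius

end QCauchy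

theorem mainTheorem4 (F K : Type*) [Field F] [Fintype F] [Field K] [Algebra F K]
    [FiniteDimensional F K] (s : ℤ) (hs : IsCoprime s (Module.finrank F K : ℤ))
    (γ : K) (hγ : Algebra.trace F K γ ≠ 0) :
    (∀ (k n : ℕ) (_hk : 0 < k) (hkn : k < n) (_hnm : n ≤ Module.finrank F K)
      (g : Fin n → K), QCauchy.qRank F g = n →
        IsUnit (QCauchy.moore F k s (fun i : Fin k => g ⟨i, i.isLt.trans hkn⟩)) ∧
        QCauchy.IsCauchy F γ s
          ((QCauchy.moore F k s (fun i : Fin k => g ⟨i, i.isLt.trans hkn⟩))⁻¹ *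
            QCauchy.moore F k s
              (fun j : Fin (n - k) => g ⟨k + j, Nat.add_lt_of_lt_sub' j.isLt⟩))) ∧
    (∀ (t r : ℕ) (R : Matrix (Fin t) (Fin r) K), QCauchy.IsCauchy F γ s R →
      ∃ g : Fin (t + r) → K, QCauchy.qRank F g = t + r ∧
        IsUnit (QCauchy.moore F t s (fun i : Fin t => g (Fin.castAdd r i))) ∧
        R = (QCauchy.moore F t s (fun i : Fin t => g (Fin.castAdd r i)))⁻¹ *
          QCauchy.moore F t s (fun j : Fin r => g (Fin.natAdd t j))) := by
  refine ⟨fun k n hk hkn _ g hg => ?_, fun t r R hR => ?_⟩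
  · have hg' := QCauchy.qRank_eq_iff.1 hg
    have hsum : LinearIndependent F (Sum.elim (fun i : Fin k => g ⟨i, i.isLt.trans hkn⟩)
        fun j : Fin (n - k) => g ⟨k + j, Nat.add_lt_of_lt_sub' j.isLt⟩) := by
      refine (linearIndependent_equiv'
        (finSumFinEquiv.trans (finCongr (Nat.add_sub_of_le hkn.le))) ?_).2 hg'
      funext x
      rcases x with i | j <;> rfl
    exact ⟨QCauchy.isUnit_moore hs (hsum.comp Sum.inl Sum.inl_injective),
      QCauchy.isCauchy_inv_moore_mul hs hγ hk hsum⟩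
  · obtain ⟨g, h, hgh, hRgh⟩ := hR.exists_eq_inv_moore_mul hγ
    refine ⟨Fin.append g h, QCauchy.qRank_eq_iff.2 ?_, ?_, ?_⟩
    · refine (linearIndependent_equiv' finSumFinEquiv ?_).1 hgh
      funext x
      rcases x with i | j <;> simp
    · simpa using QCauchy.isUnit_moore hs (hgh.comp Sum.inl Sum.inl_injective)
    · simpa using hRgh
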